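/- Let $M=(V,\to,(\mathcal X_v)_{v\in V},(K_v)_{v\in V})$ be a measure-theoretic Bayesian network with a finite vertex set: $(V,\to)$ is a directed acyclic graph, each $\mathcal X_v$ is a measurable space, and each $K_v$ is a probability kernel from $\prod_{u\to v}\mathcal X_u$ to $\mathcal X_v$. Let $\mu$ be the probability measure on $\prod_{v\in V}\mathcal X_v$ that $M$ represents: under $\mu$, for every $v$, the coordinate $X_v$ is conditionally independent of its non-descendants given its parents $X_{\mathrm{pa}(v)}$, and $K_v$ is a version of the conditional distribution of $X_v$ given $X_{\mathrm{pa}(v)}$. Let $E\subseteq V$ be a set of evidence variables, all real-valued, such that for every $i\in E$, every parent assignment $p$ and every Borel set $B\subseteq\mathbb R$ $$K_i(p,B)=\sum_{y\in B}F_i(y\mid p)+\int_B f_i(y\mid p)\,dy ,$$ where $F_i,f_i\ge 0$ are finite and $f_i$ is jointly measurable. Assume that, for every $i\in E$ and every assignment of values to the observed parents of $i$, the set of those $y\in\mathbb R$ for which $F_i(y\mid p)>0$ for at least one parent assignment $p$ extending it is countable. Let $f:\prod_v\mathcal X_v\to\mathbb R$ be measurable with $\mathbb E_\mu|f(X)|<\infty$.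 Given observed values $x_E$, lexicographic likelihood weighting (LLW) produces independent samples $x^{(1)},x^{(2)},\dots$ as follows. For each sample it visits the vertices in a fixed topological order; an evidence variable $i\in E$ is set to its observed value $x_i$, and every other variable $v$ is drawn from $K_v$ given the current values of its parents. Starting from $(d,w)=(0,1)$, at each evidence variable $i$, with current parent values $p$, it updates $$(d,w)\leftarrow\begin{cases}(d,\;w\,F_i(x_i\mid p)) & \text{if }F_i(x_i\mid p)>0,\\ (d+1,\;w\,f_i(x_i\mid p)) & \text{otherwise,}\end{cases}$$ which yields a pair $(d^{(k)},w^{(k)})$ for the $k$-th sample. With $d^*_n=\min\{d^{(k)}: k\le n,\ w^{(k)}\ne 0\}$, its estimate from $n$ samples is $$\hat f_n=\frac{\sum_{k\le n,\ d^{(k)}=d^*_n}w^{(k)}f(x^{(k)})}{\sum_{k\le n,\ d^{(k)}=d^*_n}w^{(k)}} .$$ Then LLW is consistent: for almost every value $x_E$ of the evidence (with respect to the law of $X_E$ under $\mu$), almost surely with respect to the samples, $\hat f_n\to\mathbb E_\mu[f(X)\mid X_E=x_E]$ as $n\to\infty$. -/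

import Mathlib

open MeasureTheory ProbabilityTheory Filter Topology
open scoped NNReal ENNReal

/-- A measure-theoretic Bayesian network with vertex set `V`: a well-founded digraph, a measurable
space for every vertex, and for every vertex a probability kernel from the product of the spaces of
its parents. `edge u v` means that `u` is a parent of `v`. -/
structure MTBN (V : Type*) where
  edge : V → V → Prop
  wf : WellFounded edge
  X : V → Type*
  [mX : ∀ v, MeasurableSpace (X v)]
  K : ∀ v, Kernel (∀ u : {u // edge u v}, X u) (X v)
  [markov : ∀ v, IsMarkovKernel (K v)]

namespace MTBN

attribute [instance] MTBN.mX MTBN.markov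

variable {V : Type*} (M : MTBN V)

/-- The joint space of all the variables. -/
abbrev Joint : Type _ := ∀ v, M.X v

/-- Assignments of values to the parents of `v`. -/
abbrev ParentVal (v : V) : Type _ := ∀ u : {u // M.edge u v}, M.X u

/-- The random variable formed by the parents of `v`. -/
def pa (v : V) (x : M.Joint) : M.ParentVal v := fun u => x u

/-- The random variable formed by the non-descendants of `v` (those vertices `u` to which there is
no directed path from `v`; `v` itself counts as its own descendant). -/
def nd (v : V) (x : M.Joint) : ∀ u : {u // ¬ Relation.ReflTransGen M.edge v u}, M.X u :=
  fun u => x u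

/-- The random variable formed by the vertices in `E`. -/
def obs (E : Finset V) (x : M.Joint) : ∀ u : E, M.X u := fun u => x u

/-- `M` represents the probability measure `μ`: every `X_v` is conditionally independent of its
non-descendants given its parents, and `K v` is a version of the conditional distribution of `X_v`
given its parents. -/
structure Represents (μ : Measure M.Joint) : Prop where
  prob : IsProbabilityMeasure μ
  condIndep : ∀ v, ∀ A : Set (M.X v), MeasurableSet A →
    ∀ B : Set (∀ u : {u // ¬ Relation.ReflTransGen M.edge v u}, M.X u), MeasurableSet B →
      μ⟦(fun x => x v) ⁻¹' A ∩ M.nd v ⁻¹' B | MeasurableSpace.comap (M.pa v) inferInstance⟧ =ᵐ[μ]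
        μ⟦(fun x => x v) ⁻¹' A | MeasurableSpace.comap (M.pa v) inferInstance⟧ *
          μ⟦M.nd v ⁻¹' B | MeasurableSpace.comap (M.pa v) inferInstance⟧
  condDistrib : ∀ v, ∀ A : Set (M.X v), MeasurableSet A →
    (fun x => (M.K v (M.pa v x)).real A) =ᵐ[μ]
      μ⟦(fun x => x v) ⁻¹' A | MeasurableSpace.comap (M.pa v) inferInstance⟧

/-- `L` lists every vertex exactly once, and no vertex comes before one of its parents. -/
structure IsTopologicalOrder (L : List V) : Prop where
  nodup : L.Nodup
  complete : ∀ v, v ∈ L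
  sorted : L.Pairwise (fun a b => ¬ M.edge b a)

/-- The evidence variables are real-valued (`val` identifies their spaces with `ℝ`), and the
conditional law of each of them given its parents is a mixture of a discrete part with masses
`mass v p y` (this is `F_v(y | p)`) and a part with Lebesgue density `dens v p y`
(this is `f_v(y | p)`). -/
structure MixedEvidence (E : Finset V) where
  val : ∀ v : E, M.X v ≃ᵐ ℝ
  mass : ∀ v : E, M.ParentVal v → ℝ → ℝ≥0
  dens : ∀ v : E, M.ParentVal v → ℝ → ℝ≥0
  measurable_dens : ∀ v : E, Measurable (Function.uncurry (dens v))
  mixture : ∀ (v : E) (p : M.ParentVal v) (B : Set ℝ), MeasurableSet B →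
    M.K v p (val v ⁻¹' B) = ∑' y : B, (mass v p y : ℝ≥0∞) + ∫⁻ y in B, (dens v p y : ℝ≥0∞)

lemma measurable_pa (v : V) : Measurable (M.pa v) :=
  measurable_pi_lambda _ fun _ => measurable_pi_apply _

section Sampler

variable [DecidableEq V]

/-- Visiting the vertex `v`: an evidence variable is set to its observed value, any other variable
is drawn from its kernel, given the current values of its parents. -/
noncomputable def visit (E : Finset V) (e : ∀ u : E, M.X u) (v : V) : Kernel M.Joint M.Joint :=
  if h : v ∈ E then
    Kernel.deterministic (fun x : M.Joint => Function.update x v (e ⟨v, h⟩))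
      (measurable_update'.comp (measurable_id.prodMk measurable_const))
  else
    (Kernel.id ×ₖ (M.K v).comap (M.pa v) (M.measurable_pa v)).map
      (fun q : M.Joint × M.X v => Function.update q.1 v q.2)

instance (E : Finset V) (e : ∀ u : E, M.X u) (v : V) : IsMarkovKernel (M.visit E e v) := by
  unfold visit
  split_ifs
  · infer_instance
  · exact Kernel.IsMarkovKernel.map _ measurable_update'

/-- The law of one sample: starting from arbitrary contents `x₀` (every coordinate of which is
overwritten), visit the vertices in the order in which they are listed. -/
noncomputable def sampleLaw (L : List V) (E : Finset V) (e : ∀ u : E, M.X u) (x₀ : M.Joint) :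
    Measure M.Joint :=
  L.foldl (fun ν v => ν.bind (M.visit E e v)) (Measure.dirac x₀)

instance (L : List V) (E : Finset V) (e : ∀ u : E, M.X u) (x₀ : M.Joint) :
    IsProbabilityMeasure (M.sampleLaw L E e x₀) := by
  unfold sampleLaw
  suffices h : ∀ ν : Measure M.Joint, IsProbabilityMeasure ν →
      IsProbabilityMeasure (L.foldl (fun ν v => ν.bind (M.visit E e v)) ν) from h _ inferInstance
  induction L with
  | nil => exact fun ν hν => hν
  | cons v L ih => exact fun ν hν => ih _ inferInstance

variable {M}

/-- The pair (number of densities, weight) of a sample `x`, updated at the evidence variables in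
the order of the visits, from `(0, 1)`. -/
noncomputable def MixedEvidence.score {E : Finset V} (ev : M.MixedEvidence E) (L : List V)
    (x : M.Joint) : ℕ × ℝ≥0 :=
  L.foldl
    (fun dw v =>
      if h : v ∈ E then
        if 0 < ev.mass ⟨v, h⟩ (M.pa v x) (ev.val ⟨v, h⟩ (x v)) then
          (dw.1, dw.2 * ev.mass ⟨v, h⟩ (M.pa v x) (ev.val ⟨v, h⟩ (x v)))
        else
          (dw.1 + 1, dw.2 * ev.dens ⟨v, h⟩ (M.pa v x) (ev.val ⟨v, h⟩ (x v)))
      else dw)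
    (0, 1)

/-- The least number of densities among those of the first `n` samples that have nonzero weight. -/
noncomputable def MixedEvidence.minDensities {E : Finset V} (ev : M.MixedEvidence E) (L : List V)
    (n : ℕ) (s : ℕ → M.Joint) : ℕ :=
  sInf {d | ∃ k < n, (ev.score L (s k)).2 ≠ 0 ∧ (ev.score L (s k)).1 = d}

/-- The output of lexicographic likelihood weighting on the first `n` samples of `s`. -/
noncomputable def MixedEvidence.estimate {E : Finset V} (ev : M.MixedEvidence E) (L : List V)
    (g : M.Joint → ℝ) (n : ℕ) (s : ℕ → M.Joint) : ℝ :=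
  (∑ k ∈ Finset.range n with (ev.score L (s k)).1 = ev.minDensities L n s,
      ((ev.score L (s k)).2 : ℝ) * g (s k)) /
    ∑ k ∈ Finset.range n with (ev.score L (s k)).1 = ev.minDensities L n s,
      ((ev.score L (s k)).2 : ℝ)

end Sampler

end MTBN

/-! Fix evidence e and let Q_e be the law of one LLW sample. The core is a measure ρ on evidence
values and a level N(e) such that Q_e-almost every sample has at least N(e) densities, and the
μ-integral of any measurable H ≥ 0 is ∫ρ(de) ∫ W_e H dQ_e, where W_e is the weight restricted to
samples with exactly N(e) densities (`exists_isDisintegration`).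

Both are built along the topological order. At an evidence vertex let a(y) be the Q_e-mean of the
mass F(y | pa). The observation is integrated against counting measure on {a > 0} plus Lebesgue
measure. If a(y) = 0, almost every sample has F = 0 and uses its density, so N grows by one. If a(y)
> 0, N stays, and samples with F = 0 rise above the level, which agrees with multiplying their
weight by F = 0. The countability assumption makes {a > 0} countable, so Lebesgue measure sees only
the case a = 0 (`lintegral_lintegral_eq_reference`, `weightAt_score_step`).

The local Markov property identifies μ with forward sampling (`Represents.eq_sampleLaw`). Hence X_E
has density Z(e) = ∫ W_e dQ_e with respect to ρ, so 0 < Z < ∞ at almost every observation, and Q_e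
reweighted by W_e / Z(e) is a conditional law given X_E = e (`posterior_comp`,
`condExp_ae_eq_integral_kernel`). As Z(e) > 0, eventually some sample has nonzero weight at level
N(e). From then on d* = N(e), the estimate is a ratio of two averages, and the strong law applies to
each. -/

/-! ### Integration against mixtures of atoms and densities -/

section Mixture

theorem lintegral_mixture {k : Measure ℝ} {F f : ℝ → ℝ≥0} (hf : Measurable f)
    (hk : ∀ B, MeasurableSet B → k B = ∑' y : B, (F y : ℝ≥0∞) + ∫⁻ y in B, (f y : ℝ≥0∞))
    {C : Set ℝ} (hC : C.Countable) (hF : ∀ y ∉ C, F y = 0) {G : ℝ → ℝ≥0∞} (hG : Measurable G) :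
    ∫⁻ y, G y ∂k = ∑' y : C, F y * G y + ∫⁻ y, f y * G y := by
  have : Countable C := hC
  have hk' : k = Measure.sum (fun y : C => (F y : ℝ≥0∞) • Measure.dirac (y : ℝ)) +
      volume.withDensity (fun y => (f y : ℝ≥0∞)) := by
    ext B hB
    rw [hk B hB, Measure.add_apply, Measure.sum_apply _ hB, withDensity_apply _ hB]
    congr 1
    rw [tsum_subtype B (fun y => (F y : ℝ≥0∞))]
    simp only [Measure.smul_apply, Measure.dirac_apply' _ hB, smul_eq_mul]
    rw [tsum_subtype C (fun y => (F y : ℝ≥0∞) * B.indicator 1 y)]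
    congr 1
    ext y
    by_cases hyB : y ∈ B <;> by_cases hyC : y ∈ C <;> simp [hyB, hyC, hF]
  rw [hk', lintegral_add_measure, lintegral_sum_measure,
    lintegral_withDensity_eq_lintegral_mul _ hf.coe_nnreal_ennreal hG]
  congr 1
  refine tsum_congr fun y => ?_
  rw [lintegral_smul_measure, lintegral_dirac' _ hG, smul_eq_mul]

variable {Ω : Type*} [MeasurableSpace Ω] {P : Measure Ω} {k : Kernel Ω ℝ} {F f : Ω → ℝ → ℝ≥0}

theorem lintegral_lintegral_mixture [SFinite P] (hFm : ∀ y, Measurable fun ω => F ω y)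
    (hf : Measurable (Function.uncurry f))
    (hk : ∀ ω B, MeasurableSet B →
      k ω B = ∑' y : B, (F ω y : ℝ≥0∞) + ∫⁻ y in B, (f ω y : ℝ≥0∞))
    {C : Set ℝ} (hC : C.Countable) (hF : ∀ᵐ ω ∂P, ∀ y ∉ C, F ω y = 0)
    {G : Ω → ℝ → ℝ≥0∞} (hG : Measurable (Function.uncurry G)) :
    ∫⁻ ω, ∫⁻ y, G ω y ∂(k ω) ∂P =
      ∑' y : C, ∫⁻ ω, F ω y * G ω y ∂P + ∫⁻ y, ∫⁻ ω, f ω y * G ω y ∂P := by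
  have : Countable C := hC
  have hGy : ∀ y, Measurable fun ω => G ω y := fun y =>
    hG.comp (measurable_id.prodMk measurable_const)
  have hfG : Measurable (Function.uncurry fun ω y => (f ω y : ℝ≥0∞) * G ω y) :=
    hf.coe_nnreal_ennreal.mul hG
  calc ∫⁻ ω, ∫⁻ y, G ω y ∂(k ω) ∂P
      = ∫⁻ ω, (∑' y : C, F ω y * G ω y + ∫⁻ y, f ω y * G ω y) ∂P := by
        refine lintegral_congr_ae (hF.mono fun ω hω => ?_)
        exact lintegral_mixture (hf.comp measurable_prodMk_left) (hk ω) hC hω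
          (hG.comp measurable_prodMk_left)
    _ = _ := by
        rw [lintegral_add_right _ (show Measurable fun ω => ∫⁻ y, f ω y * G ω y from
            hfG.lintegral_prod_right'),
          lintegral_tsum fun y : C => (show Measurable fun ω => F ω y * G ω y from
            (hFm y).coe_nnreal_ennreal.mul (hGy y)).aemeasurable,
          lintegral_lintegral_swap hfG.aemeasurable]

/-- The reference measure for the next observation consists of the counting measure on the atoms of
its law and of Lebesgue measure. -/
theorem lintegral_lintegral_eq_reference [IsFiniteMeasure P] (hF_le : ∀ ω y, F ω y ≤ 1)
    (hFm : Measurable (Function.uncurry F)) (hf : Measurable (Function.uncurry f))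
    (hk : ∀ ω B, MeasurableSet B →
      k ω B = ∑' y : B, (F ω y : ℝ≥0∞) + ∫⁻ y in B, (f ω y : ℝ≥0∞))
    {C : Set ℝ} (hC : C.Countable) (hF : ∀ᵐ ω ∂P, ∀ y ∉ C, F ω y = 0)
    {a : ℝ → ℝ≥0∞} (ha : ∀ y, a y = ∫⁻ ω, F ω y ∂P)
    {G : Ω → ℝ → ℝ≥0∞} (hG : Measurable (Function.uncurry G)) :
    ∫⁻ ω, ∫⁻ y, G ω y ∂(k ω) ∂P =
      ∫⁻ y, ∫⁻ ω, (if a y = 0 then f ω y else F ω y : ℝ≥0) * G ω y ∂P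
        ∂((P.bind k).withDensity (fun y => if a y = 0 then 0 else (a y)⁻¹) + volume) := by
  have : Countable C := hC
  have hFy : ∀ y, Measurable fun ω => F ω y :=
    fun y => hFm.comp (measurable_id.prodMk measurable_const)
  have ham : Measurable a := by
    have : a = fun y => ∫⁻ ω, F ω y ∂P := funext ha
    rw [this]
    exact hFm.coe_nnreal_ennreal.lintegral_prod_left'
  have ha0 : ∀ y ∉ C, a y = 0 := by
    intro y hy
    rw [ha, lintegral_eq_zero_iff (hFy y).coe_nnreal_ennreal]
    filter_upwards [hF] with ω hω
    simp [hω y hy]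
  have ha_top : ∀ y, a y ≠ ∞ := by
    intro y
    rw [ha]
    refine ((lintegral_mono (g := fun _ => 1) fun ω => ?_).trans_lt ?_).ne
    · simpa using hF_le ω y
    · simp
  have hset : MeasurableSet {y | a y = 0} := ham (measurableSet_singleton 0)
  have hvol : ∀ᵐ y : ℝ, a y = 0 := by
    filter_upwards [hC.ae_notMem volume] with y hy using ha0 y hy
  -- Weighting the law of the observation by 1/a turns its atoms into counting measure, and the
  -- value 0 off the atoms kills its continuous part. Unlike a counting measure on a chosen
  -- countable set, this form depends measurably on the earlier observations.
  set r : ℝ → ℝ≥0∞ := fun y => if a y = 0 then 0 else (a y)⁻¹ with hr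
  have hrm : Measurable r := Measurable.ite hset measurable_const ham.inv
  have hwm : Measurable (fun q : Ω × ℝ => (if a q.2 = 0 then f q.1 q.2 else F q.1 q.2)) :=
    Measurable.ite (measurable_snd hset) hf hFm
  set Q : ℝ → ℝ≥0∞ := fun y =>
    ∫⁻ ω, (if a y = 0 then f ω y else F ω y : ℝ≥0) * G ω y ∂P with hQ
  have hQm : Measurable Q := (hwm.coe_nnreal_ennreal.mul hG).lintegral_prod_left'
  rw [lintegral_add_measure, lintegral_withDensity_eq_lintegral_mul _ hrm hQm,
    Measure.lintegral_bind k.measurable.aemeasurable (hrm.mul hQm).aemeasurable,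
    lintegral_lintegral_mixture (G := fun _ y => (r * Q) y) hFy hf hk hC hF
      ((hrm.mul hQm).comp measurable_snd),
    lintegral_lintegral_mixture hFy hf hk hC hF hG]
  have hzero : ∫⁻ y, ∫⁻ ω, f ω y * (r * Q) y ∂P = 0 := by
    rw [lintegral_eq_zero_iff']
    · filter_upwards [hvol] with y hy
      simp [hr, hy]
    · exact (hf.coe_nnreal_ennreal.mul
        ((hrm.mul hQm).comp measurable_snd)).lintegral_prod_left'.aemeasurable
  rw [hzero, add_zero]
  congr 1
  · refine tsum_congr fun y => ?_
    rw [lintegral_mul_const _ (hFy y).coe_nnreal_ennreal, ← ha]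
    -- The set `C` may contain points that are not atoms of the mean law; there F vanishes almost
    -- surely, so both sides are zero.
    by_cases hy : a y = 0
    · have hGy : Measurable fun ω => G ω y := hG.comp (measurable_id.prodMk measurable_const)
      rw [hy, zero_mul, lintegral_eq_zero_iff (show Measurable fun ω => F ω y * G ω y from
        (hFy y).coe_nnreal_ennreal.mul hGy)]
      have := (lintegral_eq_zero_iff (hFy y).coe_nnreal_ennreal).1 ((ha y).symm.trans hy)
      filter_upwards [this] with ω hω
      simp only [Pi.zero_apply] at hω ⊢
      rw [hω, zero_mul]
    · simp only [Pi.mul_apply, hr, hQ, if_neg hy]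
      rw [← mul_assoc, ENNReal.mul_inv_cancel hy (ha_top y), one_mul]
  · refine lintegral_congr_ae (hvol.mono fun y hy => ?_)
    simp only [if_pos hy]

end Mixture

/-! ### Ancestral orders, the law of a sample and its score -/

namespace MTBN

variable {V : Type*} (M : MTBN V)

/-- `L` lists an ancestral set of vertices without repetition, parents first. -/
structure IsAncestralOrder (L : List V) : Prop where
  nodup : L.Nodup
  sorted : L.Pairwise (fun a b => ¬ M.edge b a)
  closed : ∀ v ∈ L, ∀ u, M.edge u v → u ∈ L

variable {M}

theorem IsTopologicalOrder.isAncestralOrder {L : List V} (h : M.IsTopologicalOrder L) :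
    M.IsAncestralOrder L :=
  ⟨h.nodup, h.sorted, fun _ _ _ _ => h.complete _⟩

theorem edge_irrefl (v : V) : ¬ M.edge v v := fun h => M.wf.asymmetric _ _ h h

namespace IsAncestralOrder

variable {L : List V} {v : V}

theorem notMem (h : M.IsAncestralOrder (L ++ [v])) : v ∉ L := fun hv =>
  (List.nodup_append.1 h.nodup).2.2 v hv v (by simp) rfl

theorem not_edge (h : M.IsAncestralOrder (L ++ [v])) {w : V} (hw : w ∈ L) : ¬ M.edge v w :=
  (List.pairwise_append.1 h.sorted).2.2 w hw v (by simp)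

theorem mem_of_edge (h : M.IsAncestralOrder (L ++ [v])) {u : V} (hu : M.edge u v) : u ∈ L := by
  have := h.closed v (by simp) u hu
  simp only [List.mem_append, List.mem_singleton] at this
  refine this.resolve_right ?_
  rintro rfl
  exact edge_irrefl _ hu

theorem of_append (h : M.IsAncestralOrder (L ++ [v])) : M.IsAncestralOrder L where
  nodup := (List.nodup_append.1 h.nodup).1
  sorted := (List.pairwise_append.1 h.sorted).1
  closed w hw u hu := by
    have := h.closed w (by simp [hw]) u hu
    simp only [List.mem_append, List.mem_singleton] at this
    refine this.resolve_right ?_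
    rintro rfl
    exact h.not_edge hw hu

end IsAncestralOrder

namespace MixedEvidence

variable {E : Finset V} (ev : M.MixedEvidence E)

theorem measurableSet_eq (ev : M.MixedEvidence E) (u : E) (y : M.X u) :
    MeasurableSet {x : M.Joint | x u = y} := by
  have : {x : M.Joint | x u = y} = (fun x : M.Joint => ev.val u (x u)) ⁻¹' {ev.val u y} := by
    ext x; simp
  rw [this]
  exact ((ev.val u).measurable.comp (measurable_pi_apply _)) (measurableSet_singleton _)

/-- Lebesgue measure ignores a singleton, so the discrete part is determined by the kernel. This
yields the bound by 1 and the joint measurability of the masses, neither of which is assumed. -/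
theorem coe_mass (v : E) (p : M.ParentVal v) (y : ℝ) :
    (ev.mass v p y : ℝ≥0∞) = M.K v p (ev.val v ⁻¹' {y}) := by
  rw [ev.mixture v p _ (measurableSet_singleton y)]
  simp

theorem mass_le_one (v : E) (p : M.ParentVal v) (y : ℝ) : ev.mass v p y ≤ 1 := by
  have : (ev.mass v p y : ℝ≥0∞) ≤ 1 := by rw [coe_mass]; exact prob_le_one
  exact_mod_cast this

theorem measurable_mass (v : E) : Measurable (Function.uncurry (ev.mass v)) := by
  have hs : MeasurableSet {q : (M.ParentVal v × ℝ) × M.X v | ev.val v q.2 = q.1.2} :=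
    measurableSet_eq_fun ((ev.val v).measurable.comp measurable_snd)
      (measurable_snd.comp measurable_fst)
  have := (Kernel.measurable_kernel_prodMk_left
    (κ := (M.K v).comap (Prod.fst : M.ParentVal v × ℝ → _) measurable_fst) hs).ennreal_toNNReal
  convert this using 1
  ext ⟨p, y⟩
  simp only [Function.uncurry, Kernel.comap_apply]
  rw [← ENNReal.toNNReal_coe (ev.mass v p y), coe_mass]
  rfl

end MixedEvidence

variable [DecidableEq V]

theorem pa_update {v w : V} (h : ¬ M.edge v w) (x : M.Joint) (y : M.X v) :
    M.pa w (Function.update x v y) = M.pa w x := by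
  ext u
  exact Function.update_of_ne (fun hu : u.1 = v => h (hu ▸ u.2)) _ _

section SampleLaw

variable {L : List V} {v : V} {E : Finset V} {e : ∀ u : E, M.X u} {x₀ : M.Joint}

theorem sampleLaw_append :
    M.sampleLaw (L ++ [v]) E e x₀ = (M.sampleLaw L E e x₀).bind (M.visit E e v) := by
  simp [sampleLaw, List.foldl_append]

theorem lintegral_visit_of_notMem (hv : v ∉ E) {H : M.Joint → ℝ≥0∞} (hH : Measurable H)
    (x : M.Joint) :
    ∫⁻ z, H z ∂(M.visit E e v x) = ∫⁻ y, H (Function.update x v y) ∂(M.K v (M.pa v x)) := by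
  rw [visit, dif_neg hv, Kernel.map_apply _ measurable_update',
    lintegral_map hH measurable_update', Kernel.lintegral_id_prod
      (f := fun q : M.Joint × M.X v => H (Function.update q.1 v q.2)) (hH.comp measurable_update'),
    Kernel.comap_apply]

theorem measurable_lintegral_update {H : M.Joint → ℝ≥0∞} (hH : Measurable H) :
    Measurable fun x => ∫⁻ y, H (Function.update x v y) ∂(M.K v (M.pa v x)) := by
  have : Measurable fun q : M.Joint × M.X v => H (Function.update q.1 v q.2) :=
    hH.comp measurable_update'
  exact this.lintegral_kernel_prod_right' (κ := (M.K v).comap (M.pa v) (M.measurable_pa v))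

theorem lintegral_sampleLaw_append_of_notMem (hv : v ∉ E) {H : M.Joint → ℝ≥0∞}
    (hH : Measurable H) :
    ∫⁻ z, H z ∂(M.sampleLaw (L ++ [v]) E e x₀) =
      ∫⁻ x, ∫⁻ y, H (Function.update x v y) ∂(M.K v (M.pa v x)) ∂(M.sampleLaw L E e x₀) := by
  rw [sampleLaw_append, Measure.lintegral_bind (Kernel.aemeasurable _) hH.aemeasurable]
  simp_rw [lintegral_visit_of_notMem hv hH]

theorem measurable_update_const (v : V) (y : M.X v) :
    Measurable fun x : M.Joint => Function.update x v y :=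
  measurable_update'.comp (measurable_id.prodMk measurable_const)

theorem sampleLaw_append_of_mem (hv : v ∈ E) :
    M.sampleLaw (L ++ [v]) E e x₀ =
      (M.sampleLaw L E e x₀).map (fun x => Function.update x v (e ⟨v, hv⟩)) := by
  rw [sampleLaw_append, visit, dif_pos hv, Measure.deterministic_comp_eq_map]

theorem ae_sampleLaw_append_of_notMem (hv : v ∉ E) {p : M.Joint → Prop}
    (hp : MeasurableSet {x | p x})
    (h : ∀ᵐ x ∂(M.sampleLaw L E e x₀), ∀ y, p (Function.update x v y)) :
    ∀ᵐ x ∂(M.sampleLaw (L ++ [v]) E e x₀), p x := by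
  have hp' : MeasurableSet {x | ¬ p x} := hp.compl
  have hind : Measurable ({x | ¬ p x}.indicator (1 : M.Joint → ℝ≥0∞)) :=
    measurable_one.indicator hp'
  rw [ae_iff, ← lintegral_indicator_one hp', lintegral_sampleLaw_append_of_notMem hv hind]
  refine (lintegral_congr_ae (h.mono fun x hx => ?_)).trans lintegral_zero
  simp [hx]

theorem ae_sampleLaw_append_of_mem (hv : v ∈ E) {p : M.Joint → Prop}
    (hp : MeasurableSet {x | p x}) :
    (∀ᵐ x ∂(M.sampleLaw (L ++ [v]) E e x₀), p x) ↔
      ∀ᵐ x ∂(M.sampleLaw L E e x₀), p (Function.update x v (e ⟨v, hv⟩)) := by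
  rw [sampleLaw_append_of_mem hv]
  exact ae_map_iff (measurable_update_const v (e ⟨v, hv⟩)).aemeasurable hp

/-- The sampler never reads an observation before visiting its vertex; the recursion on ρ can
therefore overwrite coordinates not yet visited. -/
theorem sampleLaw_update (L : List V) {v : V} (hvL : v ∉ L) (hv : v ∈ E) (e : ∀ u : E, M.X u)
    (x₀ : M.Joint) (y : M.X v) :
    M.sampleLaw L E (Function.update e ⟨v, hv⟩ y) x₀ = M.sampleLaw L E e x₀ := by
  induction L using List.reverseRecOn with
  | nil => simp only [sampleLaw, List.foldl_nil]
  | append_singleton L w ih =>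
    simp only [List.mem_append, List.mem_singleton, not_or] at hvL
    have : M.visit E (Function.update e ⟨v, hv⟩ y) w = M.visit E e w := by
      by_cases hw : w ∈ E
      · have hne : (⟨w, hw⟩ : E) ≠ ⟨v, hv⟩ := fun h => hvL.2 (congrArg Subtype.val h).symm
        simp only [visit, dif_pos hw, Function.update_of_ne hne]
      · simp only [visit, dif_neg hw]
    rw [sampleLaw_append, sampleLaw_append, ih hvL.1, this]

theorem measurable_sampleLaw (L : List V) (E : Finset V) (x₀ : M.Joint) :
    Measurable fun e => M.sampleLaw L E e x₀ := by
  induction L using List.reverseRecOn with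
  | nil => exact measurable_const
  | append_singleton L v ih =>
    by_cases hv : v ∈ E
    -- The vertex is set to a coordinate of `e`, so the pair of `e` and the sample has to be carried
    -- jointly before updating.
    · let κ : Kernel (∀ u : E, M.X u) M.Joint := ⟨_, ih⟩
      have : IsMarkovKernel κ := ⟨fun e =>
        inferInstanceAs (IsProbabilityMeasure (M.sampleLaw L E e x₀))⟩
      have hm : Measurable fun q : (∀ u : E, M.X u) × M.Joint =>
          Function.update q.2 v (q.1 ⟨v, hv⟩) :=
        (measurable_update' (a := v)).comp (measurable_snd.prodMk
          ((measurable_pi_apply (⟨v, hv⟩ : E)).comp measurable_fst))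
      convert ((Kernel.id ×ₖ κ).map
        fun q : (∀ u : E, M.X u) × M.Joint => Function.update q.2 v (q.1 ⟨v, hv⟩)).measurable
        using 2 with e
      rw [sampleLaw_append_of_mem hv]
      ext s hs
      rw [Measure.map_apply (measurable_update_const _ _) hs, Kernel.map_apply' _ hm _ hs,
        Kernel.id_prod_apply' _ _ (hm hs)]
      rfl
    · simp_rw [sampleLaw_append]
      have : ∀ e : ∀ u : E, M.X u, M.visit E e v =
          (Kernel.id ×ₖ (M.K v).comap (M.pa v) (M.measurable_pa v)).map
          (fun q : M.Joint × M.X v => Function.update q.1 v q.2) := fun e => by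
        rw [visit, dif_neg hv]
      simp_rw [this]
      exact (Measure.measurable_bind' (Kernel.measurable _)).comp ih

variable (M) in
/-- The law of one sample as a kernel of the observed values. -/
noncomputable def sampleKernel (L : List V) (E : Finset V) (x₀ : M.Joint) :
    Kernel (∀ u : E, M.X u) M.Joint :=
  ⟨fun e => M.sampleLaw L E e x₀, measurable_sampleLaw L E x₀⟩

theorem sampleKernel_apply (L : List V) (E : Finset V) (x₀ : M.Joint) (e : ∀ u : E, M.X u) :
    M.sampleKernel L E x₀ e = M.sampleLaw L E e x₀ := rfl

instance (L : List V) (E : Finset V) (x₀ : M.Joint) : IsMarkovKernel (M.sampleKernel L E x₀) :=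
  ⟨fun e => by rw [sampleKernel_apply]; infer_instance⟩

end SampleLaw

namespace MixedEvidence

variable {E : Finset V} (ev : M.MixedEvidence E)

/-- An evidence coordinate is written with its observed value, and visits to other vertices leave it
alone. -/
theorem ae_sampleLaw_eq (ev : M.MixedEvidence E) (L : List V) (e : ∀ u : E, M.X u) (x₀ : M.Joint)
    {u : V}
    (hu : u ∈ E) (huL : u ∈ L) : ∀ᵐ x ∂(M.sampleLaw L E e x₀), x u = e ⟨u, hu⟩ := by
  induction L using List.reverseRecOn with
  | nil => simp at huL
  | append_singleton L v ih =>
    have hm := ev.measurableSet_eq ⟨u, hu⟩ (e ⟨u, hu⟩)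
    by_cases huv : u = v
    · subst huv
      rw [ae_sampleLaw_append_of_mem hu hm]
      simp
    · have huL' : u ∈ L := by simpa [huv] using huL
      by_cases hv : v ∈ E
      · rw [ae_sampleLaw_append_of_mem hv hm]
        filter_upwards [ih huL'] with x hx
        rwa [Function.update_of_ne huv]
      · refine ae_sampleLaw_append_of_notMem hv hm ?_
        filter_upwards [ih huL'] with x hx y
        rwa [Function.update_of_ne huv]

/-- The update of the score at the vertex `v`. -/
noncomputable def scoreStep (v : V) (x : M.Joint) (dw : ℕ × ℝ≥0) : ℕ × ℝ≥0 :=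
  if h : v ∈ E then
    if 0 < ev.mass ⟨v, h⟩ (M.pa v x) (ev.val ⟨v, h⟩ (x v)) then
      (dw.1, dw.2 * ev.mass ⟨v, h⟩ (M.pa v x) (ev.val ⟨v, h⟩ (x v)))
    else
      (dw.1 + 1, dw.2 * ev.dens ⟨v, h⟩ (M.pa v x) (ev.val ⟨v, h⟩ (x v)))
  else dw

theorem score_append (L : List V) (v : V) (x : M.Joint) :
    ev.score (L ++ [v]) x = ev.scoreStep v x (ev.score L x) := by
  simp [score, scoreStep, List.foldl_append]

theorem measurable_score (L : List V) : Measurable (ev.score L) := by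
  induction L using List.reverseRecOn with
  | nil => exact measurable_const
  | append_singleton L v ih =>
    have : ev.score (L ++ [v]) = fun x => ev.scoreStep v x (ev.score L x) :=
      funext (ev.score_append L v)
    rw [this]
    by_cases h : v ∈ E
    · simp only [scoreStep, dif_pos h]
      have hq : Measurable fun x : M.Joint => (M.pa v x, ev.val ⟨v, h⟩ (x v)) :=
        (M.measurable_pa v).prodMk ((ev.val ⟨v, h⟩).measurable.comp (measurable_pi_apply v))
      have hF := (ev.measurable_mass ⟨v, h⟩).comp hq
      have hf := (ev.measurable_dens ⟨v, h⟩).comp hq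
      refine Measurable.ite (measurableSet_lt measurable_const hF) ?_ ?_
      · exact ih.fst.prodMk (ih.snd.mul hF)
      · exact ((measurable_of_countable (· + 1)).comp ih.fst).prodMk (ih.snd.mul hf)
    · simpa only [scoreStep, dif_neg h] using ih

theorem score_update {L : List V} {v : V} (hv : v ∉ L) (he : ∀ w ∈ L, ¬ M.edge v w)
    (x : M.Joint) (y : M.X v) : ev.score L (Function.update x v y) = ev.score L x := by
  induction L using List.reverseRecOn with
  | nil => rfl
  | append_singleton L w ih =>
    simp only [List.mem_append, List.mem_singleton, not_or] at hv he
    rw [score_append, score_append, ih hv.1 fun w hw => he w (.inl hw)]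
    simp only [scoreStep, pa_update (he w (.inr rfl)), Function.update_of_ne (Ne.symm hv.2)]

end MixedEvidence

end MTBN

/-! ### Disintegration of forward sampling along the observations -/

namespace MTBN

variable {V : Type*} {M : MTBN V}

/-- The weight of a score, counted only if its number of densities is `N`. -/
def weightAt (N : ℕ) (s : ℕ × ℝ≥0) : ℝ≥0 := if s.1 = N then s.2 else 0

theorem measurable_weightAt : Measurable (Function.uncurry weightAt) :=
  Measurable.ite (measurableSet_eq_fun (measurable_fst.comp measurable_snd) measurable_fst)
    (measurable_snd.comp measurable_snd) measurable_const

theorem le_fst_score_step {N d : ℕ} {w F f : ℝ≥0} {a : Prop} [Decidable a] (hN : N ≤ d)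
    (ha : a → F = 0) :
    (if a then N + 1 else N) ≤ (if 0 < F then (d, w * F) else (d + 1, w * f)).1 := by
  by_cases h : a
  · simp [h, ha h, hN]
  · split_ifs <;> simp <;> omega

/-- Here `a` stands for "the observation is not an atom of the mean law". If it is an atom but F = 0
for this sample, the count becomes at least N + 1, so the sample drops out just as the factor F = 0
prescribes. -/
theorem weightAt_score_step {N d : ℕ} {w F f : ℝ≥0} {a : Prop} [Decidable a] (hN : N ≤ d)
    (ha : a → F = 0) :
    weightAt (if a then N + 1 else N) (if 0 < F then (d, w * F) else (d + 1, w * f)) =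
      weightAt N (d, w) * if a then f else F := by
  by_cases h : a
  · simp [h, ha h, weightAt]
  · rcases eq_or_lt_of_le (zero_le (a := F)) with hF | hF
    · have : d + 1 ≠ N := by omega
      simp [h, ← hF, weightAt, this]
    · simp [h, hF, weightAt]

theorem measurable_comp_update [DecidableEq V] (x : M.Joint) (v : V) {H : M.Joint → ℝ≥0∞}
    (hH : Measurable H) : Measurable fun z : M.X v => H (Function.update x v z) :=
  hH.comp (measurable_update'.comp (measurable_const.prodMk measurable_id))

namespace MixedEvidence

variable {E : Finset V} (ev : M.MixedEvidence E)

theorem measurable_mass_pa (v : E) :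
    Measurable fun q : M.Joint × ℝ => ev.mass v (M.pa v q.1) q.2 :=
  (ev.measurable_mass v).comp (((M.measurable_pa v).comp measurable_fst).prodMk measurable_snd)

theorem measurable_dens_pa (v : E) :
    Measurable fun q : M.Joint × ℝ => ev.dens v (M.pa v q.1) q.2 :=
  (ev.measurable_dens v).comp (((M.measurable_pa v).comp measurable_fst).prodMk measurable_snd)

variable [DecidableEq V]

theorem score_append_update {L : List V} {v : V} (hL : M.IsAncestralOrder (L ++ [v])) (hv : v ∈ E)
    (x : M.Joint) (y : M.X v) :
    ev.score (L ++ [v]) (Function.update x v y) =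
      if 0 < ev.mass ⟨v, hv⟩ (M.pa v x) (ev.val ⟨v, hv⟩ y) then
        ((ev.score L x).1, (ev.score L x).2 * ev.mass ⟨v, hv⟩ (M.pa v x) (ev.val ⟨v, hv⟩ y))
      else
        ((ev.score L x).1 + 1,
          (ev.score L x).2 * ev.dens ⟨v, hv⟩ (M.pa v x) (ev.val ⟨v, hv⟩ y)) := by
  rw [score_append, score_update ev hL.notMem fun _ => hL.not_edge, scoreStep, dif_pos hv,
    pa_update (edge_irrefl v), Function.update_self]

theorem score_append_update_of_notMem {L : List V} {v : V} (hL : M.IsAncestralOrder (L ++ [v]))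
    (hv : v ∉ E) (x : M.Joint) (y : M.X v) :
    ev.score (L ++ [v]) (Function.update x v y) = ev.score L x := by
  rw [score_append, score_update ev hL.notMem fun _ => hL.not_edge, scoreStep, dif_neg hv]

/-- The mean mass that the kernel of `v` gives to `y` when the vertices in `L` are sampled. -/
noncomputable def meanMass (L : List V) (x₀ : M.Joint) (v : E) (e : ∀ u : E, M.X u) (y : ℝ) :
    ℝ≥0∞ :=
  ∫⁻ x, ev.mass v (M.pa v x) y ∂(M.sampleLaw L E e x₀)

theorem measurable_meanMass (L : List V) (x₀ : M.Joint) (v : E) :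
    Measurable (Function.uncurry (ev.meanMass L x₀ v)) := by
  have : Measurable fun q : ((∀ u : E, M.X u) × ℝ) × M.Joint =>
      (ev.mass v (M.pa v q.2) q.1.2 : ℝ≥0∞) :=
    ((ev.measurable_mass_pa v).comp
      (measurable_snd.prodMk (measurable_snd.comp measurable_fst))).coe_nnreal_ennreal
  exact this.lintegral_kernel_prod_right'
    (κ := (M.sampleKernel L E x₀).comap Prod.fst measurable_fst)

theorem meanMass_update {L : List V} {v u : V} (hu : u ∉ L) (huE : u ∈ E) (hv : v ∈ E)
    (x₀ : M.Joint) (e : ∀ u : E, M.X u) (z : M.X u) (y : ℝ) :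
    ev.meanMass L x₀ ⟨v, hv⟩ (Function.update e ⟨u, huE⟩ z) y = ev.meanMass L x₀ ⟨v, hv⟩ e y := by
  rw [meanMass, meanMass, sampleLaw_update L hu huE]

theorem ae_mass_eq_zero {L : List V} {x₀ : M.Joint} {v : E} {e : ∀ u : E, M.X u} {y : ℝ}
    (h : ev.meanMass L x₀ v e y = 0) :
    ∀ᵐ x ∂(M.sampleLaw L E e x₀), ev.mass v (M.pa v x) y = 0 := by
  have hm : Measurable fun x => ev.mass v (M.pa v x) y :=
    (ev.measurable_mass_pa v).comp (measurable_id.prodMk measurable_const)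
  rw [meanMass, lintegral_eq_zero_iff hm.coe_nnreal_ennreal] at h
  filter_upwards [h] with x hx
  simpa using hx

/-- The reference measure for the observation of `v`: the counting measure on the atoms of its law
given the observations `e`, plus Lebesgue measure. -/
noncomputable def refKernel (L : List V) (x₀ : M.Joint) (v : E) : Kernel (∀ u : E, M.X u) ℝ :=
  ((((M.K v).comap (M.pa v) (M.measurable_pa v)).map (ev.val v)) ∘ₖ M.sampleKernel L E x₀).withDensity
    (fun e y => if ev.meanMass L x₀ v e y = 0 then 0 else (ev.meanMass L x₀ v e y)⁻¹) +
  Kernel.const _ volume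

theorem measurable_inv_meanMass (L : List V) (x₀ : M.Joint) (v : E) :
    Measurable (Function.uncurry fun e y =>
      if ev.meanMass L x₀ v e y = 0 then 0 else (ev.meanMass L x₀ v e y)⁻¹) :=
  Measurable.ite (ev.measurable_meanMass L x₀ v (measurableSet_singleton 0)) measurable_const
    (ev.measurable_meanMass L x₀ v).inv

instance (v : E) : IsMarkovKernel
    (((M.K v).comap (M.pa v) (M.measurable_pa v)).map (ev.val v)) :=
  Kernel.IsMarkovKernel.map _ (ev.val v).measurable

instance (L : List V) (x₀ : M.Joint) (v : E) : IsSFiniteKernel (ev.refKernel L x₀ v) := by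
  have := Kernel.IsSFiniteKernel.withDensity
    (f := fun e y => if ev.meanMass L x₀ v e y = 0 then 0 else (ev.meanMass L x₀ v e y)⁻¹)
    ((((M.K v).comap (M.pa v) (M.measurable_pa v)).map (ev.val v)) ∘ₖ M.sampleKernel L E x₀)
    (fun e y => by split_ifs with h <;> simp [h])
  unfold refKernel
  infer_instance

theorem refKernel_apply (L : List V) (x₀ : M.Joint) (v : E) (e : ∀ u : E, M.X u) :
    ev.refKernel L x₀ v e =
      ((M.sampleLaw L E e x₀).bind
        (((M.K v).comap (M.pa v) (M.measurable_pa v)).map (ev.val v))).withDensity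
          (fun y => if ev.meanMass L x₀ v e y = 0 then 0 else (ev.meanMass L x₀ v e y)⁻¹) +
      volume := by
  rw [refKernel, add_apply, Kernel.const_apply,
    Kernel.withDensity_apply _ (ev.measurable_inv_meanMass L x₀ v), Kernel.comp_apply]
  rfl

theorem lintegral_lintegral_eq_refKernel [Finite V]
    (hcount : ∀ (v : E) (e : ∀ u : E, M.X u),
      {y : ℝ | ∃ p : M.ParentVal v,
        (∀ (u : {u // M.edge u v}) (hu : u.1 ∈ E), p u = e ⟨u.1, hu⟩) ∧
          ev.mass v p y ≠ 0}.Countable)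
    {L : List V} (v : E) (hL : M.IsAncestralOrder (L ++ [v.1])) (x₀ : M.Joint)
    (e : ∀ u : E, M.X u) {G : M.Joint → ℝ → ℝ≥0∞} (hG : Measurable (Function.uncurry G)) :
    ∫⁻ x, ∫⁻ z, G x (ev.val v z) ∂(M.K v (M.pa v x)) ∂(M.sampleLaw L E e x₀) =
      ∫⁻ y, ∫⁻ x, (if ev.meanMass L x₀ v e y = 0 then ev.dens v (M.pa v x) y
        else ev.mass v (M.pa v x) y : ℝ≥0) * G x y ∂(M.sampleLaw L E e x₀)
          ∂(ev.refKernel L x₀ v e) := by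
  rw [refKernel_apply]
  rw [← lintegral_lintegral_eq_reference (F := fun x y => ev.mass v (M.pa v x) y)
    (f := fun x y => ev.dens v (M.pa v x) y) (a := ev.meanMass L x₀ v e)
    (fun x y => ev.mass_le_one v (M.pa v x) y)
    (ev.measurable_mass_pa v) (ev.measurable_dens_pa v) ?_ (hcount v e) ?_ (fun y => rfl) hG]
  · refine lintegral_congr fun x => ?_
    rw [Kernel.map_apply _ (ev.val v).measurable, Kernel.comap_apply,
      lintegral_map (show Measurable (G x) from hG.comp measurable_prodMk_left)
        (ev.val v).measurable]
  · intro x B hB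
    rw [Kernel.map_apply' _ (ev.val v).measurable _ hB, Kernel.comap_apply, ev.mixture v _ B hB]
  -- Parents precede `v`, so almost every sample carries the observed values on the observed
  -- parents, and all its atoms lie in the single countable set of `hcount`.
  · have : ∀ᵐ x ∂(M.sampleLaw L E e x₀), ∀ u : {u // M.edge u v}, ∀ hu : u.1 ∈ E,
        x u = e ⟨u.1, hu⟩ := by
      rw [ae_all_iff]
      refine fun u => ?_
      by_cases hu : u.1 ∈ E
      · filter_upwards [ev.ae_sampleLaw_eq L e x₀ hu (hL.mem_of_edge u.2)] with x hx _ using hx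
      · exact ae_of_all _ fun x h => (hu h).elim
    filter_upwards [this] with x hx y hy
    by_contra h
    exact hy ⟨M.pa v x, hx, h⟩

/-- The observations `e` are distributed as `ρ`, up to the normalization of the likelihood weights,
and `N e` is the least possible number of densities. -/
structure IsDisintegration (L : List V) (x₀ : M.Joint) (ρ : Measure (∀ u : E, M.X u))
    (N : (∀ u : E, M.X u) → ℕ) : Prop where
  measurable : Measurable N
  update : ∀ v (hv : v ∈ E), v ∉ L → ∀ e y, N (Function.update e ⟨v, hv⟩ y) = N e
  le_score : ∀ e, ∀ᵐ x ∂(M.sampleLaw L E e x₀), N e ≤ (ev.score L x).1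
  lintegral_eq : ∀ H : M.Joint → ℝ≥0∞, Measurable H →
    ∫⁻ x, H x ∂(M.sampleLaw L ∅ (M.obs ∅ x₀) x₀) =
      ∫⁻ e, ∫⁻ x, weightAt (N e) (ev.score L x) * H x ∂(M.sampleLaw L E e x₀) ∂ρ

theorem measurable_weightAt_score (L : List V) (n : ℕ) :
    Measurable fun x => (weightAt n (ev.score L x) : ℝ≥0∞) :=
  (measurable_weightAt.comp
    (measurable_const.prodMk (ev.measurable_score L))).coe_nnreal_ennreal

theorem measurable_weightAt_score_uncurry (L : List V) {N : (∀ u : E, M.X u) → ℕ}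
    (hN : Measurable N) :
    Measurable fun q : (∀ u : E, M.X u) × M.Joint =>
      (weightAt (N q.1) (ev.score L q.2) : ℝ≥0∞) :=
  (measurable_weightAt.comp ((hN.comp measurable_fst).prodMk
    ((ev.measurable_score L).comp measurable_snd))).coe_nnreal_ennreal

theorem measurableSet_le_score (L : List V) (n : ℕ) :
    MeasurableSet {x | n ≤ (ev.score L x).1} :=
  measurableSet_le measurable_const (ev.measurable_score L).fst

theorem measurable_weightAt_score_mul (L : List V) (n : ℕ) {H : M.Joint → ℝ≥0∞}
    (hH : Measurable H) : Measurable fun x => weightAt n (ev.score L x) * H x :=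
  (ev.measurable_weightAt_score L n).mul hH

/-- Both samplers draw `v` from the same kernel, and the score ignores the value drawn, so the
weight comes out of the inner integral. -/
theorem IsDisintegration.append_of_notMem {L : List V} {v : V} {x₀ : M.Joint}
    {ρ : Measure (∀ u : E, M.X u)} {N : (∀ u : E, M.X u) → ℕ}
    (h : ev.IsDisintegration L x₀ ρ N) (hL : M.IsAncestralOrder (L ++ [v])) (hv : v ∉ E) :
    ev.IsDisintegration (L ++ [v]) x₀ ρ N where
  measurable := h.measurable
  update u hu huL := h.update u hu fun h => huL (List.mem_append_left _ h)
  le_score e := by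
    refine ae_sampleLaw_append_of_notMem hv (ev.measurableSet_le_score _ _) ?_
    filter_upwards [h.le_score e] with x hx y
    rwa [ev.score_append_update_of_notMem hL hv]
  lintegral_eq H hH := by
    rw [lintegral_sampleLaw_append_of_notMem (by simp) hH,
      h.lintegral_eq _ (measurable_lintegral_update hH)]
    refine lintegral_congr fun e => ?_
    rw [lintegral_sampleLaw_append_of_notMem hv (ev.measurable_weightAt_score_mul _ _ hH)]
    refine lintegral_congr fun x => ?_
    simp_rw [ev.score_append_update_of_notMem hL hv]
    rw [lintegral_const_mul _ (measurable_comp_update x v hH)]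

/-- The least number of densities after the observation of `v`. -/
noncomputable def leastStep (L : List V) (x₀ : M.Joint) (v : E) (N : (∀ u : E, M.X u) → ℕ)
    (e : ∀ u : E, M.X u) : ℕ :=
  if ev.meanMass L x₀ v e (ev.val v (e v)) = 0 then N e + 1 else N e

theorem measurable_leastStep (L : List V) (x₀ : M.Joint) (v : E) {N : (∀ u : E, M.X u) → ℕ}
    (hN : Measurable N) : Measurable (ev.leastStep L x₀ v N) := by
  have hval : Measurable fun e : ∀ u : E, M.X u => (e, ev.val v (e v)) :=
    measurable_id.prodMk ((ev.val v).measurable.comp (measurable_pi_apply v))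
  have ham := (ev.measurable_meanMass L x₀ v).comp hval
  unfold leastStep
  exact Measurable.ite (measurableSet_eq_fun ham measurable_const) (hN.add_const 1) hN

theorem measurable_update_symm (v : E) : Measurable fun q : (∀ u : E, M.X u) × ℝ =>
    Function.update q.1 v ((ev.val v).symm q.2) :=
  (measurable_update' (a := v)).comp
    (measurable_fst.prodMk ((ev.val v).symm.measurable.comp measurable_snd))

theorem ae_meanMass_imp (L : List V) (x₀ : M.Joint) (v : E) (e : ∀ u : E, M.X u) (y : ℝ) :
    ∀ᵐ x ∂(M.sampleLaw L E e x₀), ev.meanMass L x₀ v e y = 0 → ev.mass v (M.pa v x) y = 0 := by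
  by_cases h : ev.meanMass L x₀ v e y = 0
  · filter_upwards [ev.ae_mass_eq_zero h] with x hx _ using hx
  · exact ae_of_all _ fun x h' => (h h').elim

theorem leastStep_update {L : List V} {v : V} (hv : v ∈ E) (hvL : v ∉ L) (x₀ : M.Joint)
    {N : (∀ u : E, M.X u) → ℕ} (e : ∀ u : E, M.X u) (z : M.X v)
    (hN : N (Function.update e ⟨v, hv⟩ z) = N e) :
    ev.leastStep L x₀ ⟨v, hv⟩ N (Function.update e ⟨v, hv⟩ z) =
      if ev.meanMass L x₀ ⟨v, hv⟩ e (ev.val ⟨v, hv⟩ z) = 0 then N e + 1 else N e := by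
  rw [leastStep, ev.meanMass_update hvL hv hv, hN, Function.update_self]

/-- The observation of `v` is drawn from the reference measure. -/
noncomputable def observe (L : List V) (x₀ : M.Joint) (v : E) :
    Kernel (∀ u : E, M.X u) (∀ u : E, M.X u) :=
  (Kernel.id ×ₖ ev.refKernel L x₀ v).map fun q : (∀ u : E, M.X u) × ℝ =>
    Function.update q.1 v ((ev.val v).symm q.2)

theorem lintegral_observe (L : List V) (x₀ : M.Joint) (v : E) (e : ∀ u : E, M.X u)
    {Φ : (∀ u : E, M.X u) → ℝ≥0∞} (hΦ : Measurable Φ) :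
    ∫⁻ e', Φ e' ∂(ev.observe L x₀ v e) =
      ∫⁻ y, Φ (Function.update e v ((ev.val v).symm y)) ∂(ev.refKernel L x₀ v e) := by
  rw [observe, Kernel.map_apply _ (ev.measurable_update_symm v),
    lintegral_map hΦ (ev.measurable_update_symm v), Kernel.lintegral_id_prod
      (f := fun q : (∀ u : E, M.X u) × ℝ => Φ (Function.update q.1 v ((ev.val v).symm q.2)))
      (hΦ.comp (ev.measurable_update_symm v))]

/-- Undoes the visit to an evidence vertex: what remains is the weight at the old level times one
new factor, a density or a mass according to whether the mean mass is zero. -/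
theorem lintegral_weightAt_append {L : List V} {v : V} (hL : M.IsAncestralOrder (L ++ [v]))
    (hv : v ∈ E) {x₀ : M.Joint} {ρ : Measure (∀ u : E, M.X u)} {N : (∀ u : E, M.X u) → ℕ}
    (h : ev.IsDisintegration L x₀ ρ N) {H : M.Joint → ℝ≥0∞} (hH : Measurable H)
    (e : ∀ u : E, M.X u) (z : M.X v) :
    ∫⁻ x, weightAt (ev.leastStep L x₀ ⟨v, hv⟩ N (Function.update e ⟨v, hv⟩ z))
        (ev.score (L ++ [v]) x) * H x
        ∂(M.sampleLaw (L ++ [v]) E (Function.update e ⟨v, hv⟩ z) x₀) =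
      ∫⁻ x, (if ev.meanMass L x₀ ⟨v, hv⟩ e (ev.val ⟨v, hv⟩ z) = 0 then
          ev.dens ⟨v, hv⟩ (M.pa v x) (ev.val ⟨v, hv⟩ z)
        else ev.mass ⟨v, hv⟩ (M.pa v x) (ev.val ⟨v, hv⟩ z) : ℝ≥0) *
          (weightAt (N e) (ev.score L x) * H (Function.update x v z))
        ∂(M.sampleLaw L E e x₀) := by
  rw [sampleLaw_append_of_mem hv, sampleLaw_update L hL.notMem hv,
    lintegral_map (ev.measurable_weightAt_score_mul _ _ hH) (measurable_update_const _ _),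
    Function.update_self, ev.leastStep_update hv hL.notMem x₀ e z (h.update v hv hL.notMem e z)]
  refine lintegral_congr_ae ?_
  filter_upwards [h.le_score e, ev.ae_meanMass_imp L x₀ ⟨v, hv⟩ e (ev.val ⟨v, hv⟩ z)]
    with x hx hFx
  rw [ev.score_append_update hL hv, weightAt_score_step hx hFx, ENNReal.coe_mul]
  ring

theorem IsDisintegration.append_of_mem [Finite V]
    (hcount : ∀ (v : E) (e : ∀ u : E, M.X u),
      {y : ℝ | ∃ p : M.ParentVal v,
        (∀ (u : {u // M.edge u v}) (hu : u.1 ∈ E), p u = e ⟨u.1, hu⟩) ∧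
          ev.mass v p y ≠ 0}.Countable)
    {L : List V} {v : V} {x₀ : M.Joint}
    {ρ : Measure (∀ u : E, M.X u)} {N : (∀ u : E, M.X u) → ℕ}
    (h : ev.IsDisintegration L x₀ ρ N) (hL : M.IsAncestralOrder (L ++ [v])) (hv : v ∈ E) :
    ev.IsDisintegration (L ++ [v]) x₀ (ρ.bind (ev.observe L x₀ ⟨v, hv⟩))
      (ev.leastStep L x₀ ⟨v, hv⟩ N) where
  measurable := ev.measurable_leastStep L x₀ _ h.measurable
  update u hu huL e y := by
    simp only [List.mem_append, List.mem_singleton, not_or] at huL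
    have hne : (⟨v, hv⟩ : E) ≠ ⟨u, hu⟩ := fun h => huL.2 (congrArg Subtype.val h).symm
    simp only [leastStep, ev.meanMass_update huL.1 hu hv, h.update u hu huL.1,
      Function.update_of_ne hne]
  le_score e := by
    rw [ae_sampleLaw_append_of_mem hv (ev.measurableSet_le_score _ _)]
    filter_upwards [h.le_score e, ev.ae_meanMass_imp L x₀ ⟨v, hv⟩ e (ev.val ⟨v, hv⟩ (e ⟨v, hv⟩))]
      with x hx hFx
    rw [ev.score_append_update hL hv]
    exact le_fst_score_step hx hFx
  lintegral_eq H hH := by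
    have hΦ : Measurable fun e => ∫⁻ x, weightAt (ev.leastStep L x₀ ⟨v, hv⟩ N e)
        (ev.score (L ++ [v]) x) * H x ∂(M.sampleLaw (L ++ [v]) E e x₀) :=
      ((ev.measurable_weightAt_score_uncurry (L ++ [v])
        (ev.measurable_leastStep L x₀ ⟨v, hv⟩ h.measurable)).mul
          (hH.comp measurable_snd)).lintegral_kernel_prod_right'
            (κ := M.sampleKernel (L ++ [v]) E x₀)
    rw [lintegral_sampleLaw_append_of_notMem (by simp) hH,
      h.lintegral_eq _ (measurable_lintegral_update hH),
      Measure.lintegral_bind (Kernel.aemeasurable _) hΦ.aemeasurable]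
    refine lintegral_congr fun e => ?_
    rw [ev.lintegral_observe _ _ _ _ hΦ]
    simp_rw [ev.lintegral_weightAt_append hL hv h hH, MeasurableEquiv.apply_symm_apply]
    have hupd : Measurable fun q : M.Joint × ℝ =>
        Function.update q.1 v ((ev.val ⟨v, hv⟩).symm q.2) :=
      (measurable_update' (a := v)).comp
        (measurable_fst.prodMk ((ev.val ⟨v, hv⟩).symm.measurable.comp measurable_snd))
    have hG : Measurable (Function.uncurry fun (x : M.Joint) (y : ℝ) =>
        weightAt (N e) (ev.score L x) * H (Function.update x v ((ev.val ⟨v, hv⟩).symm y))) :=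
      ((ev.measurable_weightAt_score L (N e)).comp measurable_fst).mul (hH.comp hupd)
    -- For fixed earlier observations, drawing `v` from its kernel is exchanged for integrating its
    -- value against the reference measure with the new likelihood factor.
    refine Eq.trans ?_ (ev.lintegral_lintegral_eq_refKernel hcount ⟨v, hv⟩ hL x₀ e hG)
    refine lintegral_congr fun x => ?_
    simp_rw [MeasurableEquiv.symm_apply_apply]
    rw [lintegral_const_mul _ (measurable_comp_update x v hH)]

/-- The likelihood weights with the least possible number of densities disintegrate the law of the
network along the observations. -/
theorem exists_isDisintegration [Finite V]
    (hcount : ∀ (v : E) (e : ∀ u : E, M.X u),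
      {y : ℝ | ∃ p : M.ParentVal v,
        (∀ (u : {u // M.edge u v}) (hu : u.1 ∈ E), p u = e ⟨u.1, hu⟩) ∧
          ev.mass v p y ≠ 0}.Countable)
    {L : List V} (hL : M.IsAncestralOrder L) (x₀ : M.Joint) :
    ∃ ρ N, ev.IsDisintegration L x₀ ρ N := by
  induction L using List.reverseRecOn with
  | nil =>
    refine ⟨Measure.dirac (M.obs E x₀), fun _ => 0, measurable_const, fun _ _ _ _ _ => rfl,
      fun e => ae_of_all _ fun x => Nat.zero_le _, fun H hH => ?_⟩
    simp [sampleLaw, score, weightAt, lintegral_dirac' _ hH]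
  | append_singleton L v ih =>
    obtain ⟨ρ, N, h⟩ := ih hL.of_append
    by_cases hv : v ∈ E
    · exact ⟨_, _, h.append_of_mem ev hcount hL hv⟩
    · exact ⟨_, _, h.append_of_notMem ev hL hv⟩

end MixedEvidence

end MTBN

/-! ### The represented measure is the law of forward sampling -/

namespace MTBN

variable {V : Type*} {M : MTBN V}

theorem measurable_nd (v : V) : Measurable (M.nd v) :=
  measurable_pi_lambda _ fun _ => measurable_pi_apply _

/-- Conditional independence factors the conditional probability of the intersection given the
parents; the kernel factor is a function of the parents, so it moves inside the conditional
expectation of the indicator, and integration removes the conditioning. -/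
theorem Represents.measure_inter {μ : Measure M.Joint} (hμ : M.Represents μ) (v : V)
    {A : Set (M.X v)} (hA : MeasurableSet A)
    {B : Set (∀ u : {u // ¬ Relation.ReflTransGen M.edge v u}, M.X u)} (hB : MeasurableSet B) :
    μ ((fun x => x v) ⁻¹' A ∩ M.nd v ⁻¹' B) = ∫⁻ x in M.nd v ⁻¹' B, M.K v (M.pa v x) A ∂μ := by
  have := hμ.prob
  have hm : MeasurableSpace.comap (M.pa v) inferInstance ≤
      (inferInstance : MeasurableSpace M.Joint) :=
    (M.measurable_pa v).comap_le
  have hSA : MeasurableSet ((fun x : M.Joint => x v) ⁻¹' A) := measurable_pi_apply v hA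
  have hSB : MeasurableSet (M.nd v ⁻¹' B) := measurable_nd v hB
  have hK : Measurable fun x => M.K v (M.pa v x) A :=
    ((M.K v).measurable_coe hA).comp (M.measurable_pa v)
  set k : M.Joint → ℝ := fun x => (M.K v (M.pa v x)).real A with hk
  have hkm : StronglyMeasurable[MeasurableSpace.comap (M.pa v) inferInstance] k :=
    (((M.K v).measurable_coe hA).ennreal_toReal.comp
      (comap_measurable (M.pa v))).stronglyMeasurable
  set b : M.Joint → ℝ := (M.nd v ⁻¹' B).indicator fun _ => 1 with hb
  have hbi : Integrable b μ := (integrable_const 1).indicator hSB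
  have hkb : k * b = (M.nd v ⁻¹' B).indicator k := by
    ext x
    by_cases hx : x ∈ M.nd v ⁻¹' B <;> simp [hb, hx]
  have hki : Integrable k μ :=
    Integrable.of_bound (hkm.mono hm).aestronglyMeasurable 1
      (ae_of_all _ fun x => by simp [hk, abs_of_nonneg, measureReal_le_one])
  have hkbi : Integrable (k * b) μ := hkb ▸ hki.indicator hSB
  have hreal : μ.real ((fun x => x v) ⁻¹' A ∩ M.nd v ⁻¹' B) = ∫ x in M.nd v ⁻¹' B, k x ∂μ := by
    calc μ.real ((fun x => x v) ⁻¹' A ∩ M.nd v ⁻¹' B)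
        = ∫ x, ((fun x : M.Joint => x v) ⁻¹' A ∩ M.nd v ⁻¹' B).indicator (fun _ => (1 : ℝ)) x ∂μ := by
          rw [integral_indicator_const _ (hSA.inter hSB)]; simp
      _ = ∫ x, (μ⟦(fun x => x v) ⁻¹' A ∩ M.nd v ⁻¹' B |
            MeasurableSpace.comap (M.pa v) inferInstance⟧) x ∂μ := (integral_condExp hm).symm
      _ = ∫ x, (k * μ[b | MeasurableSpace.comap (M.pa v) inferInstance]) x ∂μ := by
          refine integral_congr_ae ?_
          filter_upwards [hμ.condIndep v A hA B hB, hμ.condDistrib v A hA] with x hx hx'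
          rw [hx, Pi.mul_apply, Pi.mul_apply, ← hx']
      _ = ∫ x, (μ[k * b | MeasurableSpace.comap (M.pa v) inferInstance]) x ∂μ :=
          (integral_congr_ae (condExp_mul_of_stronglyMeasurable_left hkm hkbi hbi)).symm
      _ = ∫ x, (k * b) x ∂μ := integral_condExp hm
      _ = ∫ x in M.nd v ⁻¹' B, k x ∂μ := by rw [hkb, integral_indicator hSB]
  have hfin : ∫⁻ x in M.nd v ⁻¹' B, M.K v (M.pa v x) A ∂μ ≠ ∞ := by
    refine ((lintegral_mono (g := fun _ => 1) fun x => prob_le_one).trans_lt ?_).ne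
    simp
  rw [← ENNReal.toReal_eq_toReal_iff' (measure_ne_top _ _) hfin]
  refine hreal.trans ?_
  rw [← integral_toReal hK.aemeasurable (ae_of_all _ fun x => measure_lt_top _ _)]
  rfl

theorem IsAncestralOrder.not_reflTransGen {L : List V} {v : V}
    (h : M.IsAncestralOrder (L ++ [v])) {u : V} (hu : u ∈ L) :
    ¬ Relation.ReflTransGen M.edge v u := fun hvu => by
  induction hvu with
  | refl => exact h.notMem hu
  | tail _ hwu ih => exact ih (h.of_append.closed _ hu _ hwu)

variable [DecidableEq V]

variable (M) in
/-- Keep the coordinates listed in `L` and reset the others to those of `x₀`. -/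
def reset (L : List V) (x₀ x : M.Joint) : M.Joint := fun u => if u ∈ L then x u else x₀ u

theorem measurable_reset (L : List V) (x₀ : M.Joint) : Measurable (M.reset L x₀) := by
  refine measurable_pi_lambda _ fun u => ?_
  by_cases hu : u ∈ L
  · simpa [reset, hu] using measurable_pi_apply u
  · simp [reset, hu]

theorem reset_append (L : List V) (v : V) (x₀ x : M.Joint) :
    M.reset (L ++ [v]) x₀ x = Function.update (M.reset L x₀ x) v (x v) := by
  ext u
  by_cases huv : u = v
  · subst huv; simp [reset]
  · simp [reset, huv]

theorem IsAncestralOrder.pa_reset {L : List V} {v : V} (h : M.IsAncestralOrder (L ++ [v]))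
    (x₀ x : M.Joint) : M.pa v (M.reset L x₀ x) = M.pa v x := by
  ext u
  exact if_pos (h.mem_of_edge u.2)

theorem Represents.map_reset_prodMk {μ : Measure M.Joint} (hμ : M.Represents μ) {L : List V} {v : V}
    (h : M.IsAncestralOrder (L ++ [v])) (x₀ : M.Joint) :
    μ.map (fun x => (M.reset L x₀ x, x v)) =
      μ.bind (Kernel.deterministic (M.reset L x₀) (measurable_reset L x₀) ×ₖ
        (M.K v).comap (M.pa v) (M.measurable_pa v)) := by
  have := hμ.prob
  have hmeas : Measurable fun x : M.Joint => (M.reset L x₀ x, x v) :=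
    (measurable_reset L x₀).prodMk (measurable_pi_apply v)
  have := Measure.isProbabilityMeasure_map (μ := μ) hmeas.aemeasurable
  refine Measure.ext_prod fun {s t} hs ht => ?_
  classical
  -- Every vertex of `L` is a non-descendant of `v`, so resetting the rest factors through the
  -- non-descendants.
  let r : (∀ u : {u // ¬ Relation.ReflTransGen M.edge v u}, M.X u) → M.Joint := fun z u =>
    if hu : u ∈ L then z ⟨u, h.not_reflTransGen hu⟩ else x₀ u
  have hr : Measurable r := by
    refine measurable_pi_lambda _ fun u => ?_
    by_cases hu : u ∈ L
    · simpa only [r, hu, dite_true] using measurable_pi_apply _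
    · simp only [r, hu, dite_false, measurable_const]
  have hrs : M.reset L x₀ ⁻¹' s = M.nd v ⁻¹' (r ⁻¹' s) := rfl
  rw [Measure.map_apply hmeas (hs.prod ht),
    Measure.bind_apply (hs.prod ht) (Kernel.aemeasurable _)]
  have hinter : (fun x : M.Joint => (M.reset L x₀ x, x v)) ⁻¹' s ×ˢ t =
      (fun x => x v) ⁻¹' t ∩ M.nd v ⁻¹' (r ⁻¹' s) := by
    rw [← hrs]; ext x; simp [and_comm]
  rw [hinter, hμ.measure_inter v ht (hr hs), ← hrs,
    ← lintegral_indicator (measurable_reset L x₀ hs)]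
  refine lintegral_congr fun x => ?_
  rw [Kernel.prod_apply, Measure.prod_prod, Kernel.comap_apply, Kernel.deterministic_apply' _ _ hs]
  by_cases hx : M.reset L x₀ x ∈ s <;> simp [hx]

/-- Resetting unvisited coordinates to `x₀` represents the marginals on all prefixes in one space,
where they obey the recursion of forward sampling. -/
theorem Represents.map_reset {μ : Measure M.Joint} (hμ : M.Represents μ) {L : List V}
    (h : M.IsAncestralOrder L) (x₀ : M.Joint) :
    μ.map (M.reset L x₀) = M.sampleLaw L ∅ (M.obs ∅ x₀) x₀ := by
  have := hμ.prob
  induction L using List.reverseRecOn with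
  | nil =>
    have : M.reset [] x₀ = fun _ => x₀ := by ext; simp [reset]
    rw [this, Measure.map_const]
    simp [sampleLaw]
  | append_singleton L v ih =>
    refine Measure.ext_of_lintegral _ fun H hH => ?_
    have hq : Measurable fun q : M.Joint × M.X v => H (Function.update q.1 v q.2) :=
      hH.comp measurable_update'
    have hmeas : Measurable fun x : M.Joint => (M.reset L x₀ x, x v) :=
      (measurable_reset L x₀).prodMk (measurable_pi_apply v)
    rw [lintegral_sampleLaw_append_of_notMem (by simp) hH, ← ih h.of_append,
      lintegral_map (measurable_lintegral_update hH) (measurable_reset L x₀),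
      lintegral_map hH (measurable_reset _ x₀)]
    simp_rw [reset_append, h.pa_reset]
    rw [← lintegral_map (f := fun q : M.Joint × M.X v => H (Function.update q.1 v q.2)) hq hmeas,
      hμ.map_reset_prodMk h, Measure.lintegral_bind (Kernel.aemeasurable _) hq.aemeasurable]
    refine lintegral_congr fun x => ?_
    rw [Kernel.lintegral_deterministic_prod _ _ _ hq, Kernel.comap_apply]

theorem Represents.eq_sampleLaw {μ : Measure M.Joint} (hμ : M.Represents μ) {L : List V}
    (h : M.IsTopologicalOrder L) (x₀ : M.Joint) : M.sampleLaw L ∅ (M.obs ∅ x₀) x₀ = μ := by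
  have : M.reset L x₀ = id := by
    ext x u
    exact if_pos (h.complete u)
  rw [← hμ.map_reset h.isAncestralOrder, this, Measure.map_id]

end MTBN

/-! ### Conditional expectation from a disintegration, and the strong law -/

/-- The kernel at `e` lives on the fibre `o = e`, where the indicator of an event in terms of `o` is
constant; this gives the defining identity of conditional expectation on every such event. -/
theorem condExp_ae_eq_integral_kernel {Ω 𝓔 : Type*} [mΩ : MeasurableSpace Ω]
    [m𝓔 : MeasurableSpace 𝓔]
    {μ : Measure Ω} [IsFiniteMeasure μ] {o : Ω → 𝓔} (ho : Measurable o) {κ : Kernel 𝓔 Ω}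
    (hμ : κ ∘ₘ (μ.map o) = μ) (hκ : ∀ᵐ e ∂(μ.map o), ∀ᵐ x ∂(κ e), o x = e) {g : Ω → ℝ}
    (hg : Measurable g) (hgi : Integrable g μ) :
    μ[g | MeasurableSpace.comap o m𝓔] =ᵐ[μ] fun x => ∫ y, g y ∂(κ (o x)) := by
  have hint : ∀ F : Ω → ℝ, Integrable F μ →
      Integrable (fun e => ∫ y, F y ∂(κ e)) (μ.map o) ∧
        ∫ x, F x ∂μ = ∫ e, ∫ y, F y ∂(κ e) ∂(μ.map o) := by
    intro F hF
    rw [← hμ, Measure.comp_eq_comp_const_apply] at hF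
    refine ⟨by simpa using hF.integral_comp, ?_⟩
    conv_lhs => rw [← hμ, Measure.comp_eq_comp_const_apply]
    rw [Kernel.integral_comp hF]
    simp
  have hsm : StronglyMeasurable fun e => ∫ y, g y ∂(κ e) := hg.stronglyMeasurable.integral_kernel
  have hi : Integrable (fun x => ∫ y, g y ∂(κ (o x))) μ := (hint g hgi).1.comp_measurable ho
  refine (ae_eq_condExp_of_forall_setIntegral_eq ho.comap_le hgi (fun _ _ _ => hi.integrableOn)
    ?_ (hsm.comp_measurable (comap_measurable o)).aestronglyMeasurable).symm
  rintro s ⟨B, hB, rfl⟩ -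
  rw [← integral_indicator (f := g) (ho hB), (hint _ (hgi.indicator (ho hB))).2,
    ← setIntegral_map hB hsm.aestronglyMeasurable ho.aemeasurable, ← integral_indicator hB]
  refine integral_congr_ae ?_
  filter_upwards [hκ] with e he
  have : ∀ᵐ x ∂(κ e), (o ⁻¹' B).indicator g x = B.indicator (fun _ => g x) e := by
    filter_upwards [he] with x hx
    by_cases hB : e ∈ B <;> simp [hx, hB]
  rw [integral_congr_ae this]
  by_cases hB : e ∈ B <;> simp [hB]

theorem ae_tendsto_average_infinitePi {Ω : Type*} [MeasurableSpace Ω] {ν : Measure Ω}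
    [IsProbabilityMeasure ν] {φ : Ω → ℝ} (hφ : Measurable φ) (hφi : Integrable φ ν) :
    ∀ᵐ s ∂(Measure.infinitePi fun _ : ℕ => ν),
      Tendsto (fun n : ℕ => (∑ i ∈ Finset.range n, φ (s i)) / n) atTop (𝓝 (∫ x, φ x ∂ν)) := by
  have hmp := fun i : ℕ => measurePreserving_eval_infinitePi (fun _ : ℕ => ν) i
  have hind : iIndepFun (fun (i : ℕ) (s : ℕ → Ω) => φ (s i)) (Measure.infinitePi fun _ : ℕ => ν) :=
    iIndepFun_infinitePi (X := fun _ => φ) fun _ => hφ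
  have hmap : ∀ i : ℕ, (Measure.infinitePi fun _ : ℕ => ν).map (fun s => φ (s i)) = ν.map φ := by
    intro i
    conv_rhs => rw [← (hmp i).map_eq, Measure.map_map hφ (measurable_pi_apply i)]
    rfl
  have hm : ∀ i : ℕ, Measurable fun s : ℕ → Ω => φ (s i) := fun i =>
    hφ.comp (measurable_pi_apply i)
  have h0 : ∫ s : ℕ → Ω, φ (s 0) ∂(Measure.infinitePi fun _ : ℕ => ν) = ∫ x, φ x ∂ν := by
    conv_rhs => rw [← (hmp 0).map_eq]
    rw [integral_map (measurable_pi_apply 0).aemeasurable hφ.aestronglyMeasurable]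
  rw [← h0]
  refine strong_law_ae_real (fun (i : ℕ) (s : ℕ → Ω) => φ (s i))
    ((hmp 0).integrable_comp_of_integrable hφi) (fun i j hij => hind.indepFun hij) fun i => ?_
  exact ⟨(hm i).aemeasurable, (hm 0).aemeasurable, by rw [hmap, hmap]⟩

/-! ### Convergence of the estimates at a fixed level -/

namespace MTBN

variable {V : Type*} {M : MTBN V}

theorem measurable_obs (E : Finset V) : Measurable (M.obs E) :=
  measurable_pi_lambda _ fun _ => measurable_pi_apply _

namespace MixedEvidence

variable [DecidableEq V] {E : Finset V} (ev : M.MixedEvidence E)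

theorem minDensities_eq {L : List V} {s : ℕ → M.Joint} {N n : ℕ}
    (hle : ∀ k, N ≤ (ev.score L (s k)).1)
    (hex : ∃ k < n, weightAt N (ev.score L (s k)) ≠ 0) : ev.minDensities L n s = N := by
  obtain ⟨k, hk, hw⟩ := hex
  have hmem : N ∈ {d | ∃ k < n, (ev.score L (s k)).2 ≠ 0 ∧ (ev.score L (s k)).1 = d} := by
    refine ⟨k, hk, ?_⟩
    by_cases h : (ev.score L (s k)).1 = N
    · exact ⟨by simpa [weightAt, h] using hw, h⟩
    · simp [weightAt, h] at hw
  refine le_antisymm (Nat.sInf_le hmem) (le_csInf ⟨N, hmem⟩ ?_)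
  rintro d ⟨j, -, -, rfl⟩
  exact hle j

theorem estimate_eq {L : List V} {s : ℕ → M.Joint} {N n : ℕ} (g : M.Joint → ℝ)
    (h : ev.minDensities L n s = N) :
    ev.estimate L g n s =
      (∑ k ∈ Finset.range n, (weightAt N (ev.score L (s k)) : ℝ) * g (s k)) /
        ∑ k ∈ Finset.range n, (weightAt N (ev.score L (s k)) : ℝ) := by
  rw [estimate, h, Finset.sum_filter, Finset.sum_filter]
  congr 1
  · refine Finset.sum_congr rfl fun k _ => ?_
    by_cases hk : (ev.score L (s k)).1 = N <;> simp [weightAt, hk]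
  · refine Finset.sum_congr rfl fun k _ => ?_
    by_cases hk : (ev.score L (s k)).1 = N <;> simp [weightAt, hk]

theorem ae_tendsto_estimate {L : List V} {ν : Measure M.Joint} [IsProbabilityMeasure ν] {N : ℕ}
    (hle : ∀ᵐ x ∂ν, N ≤ (ev.score L x).1) {g : M.Joint → ℝ} (hg : Measurable g)
    (hWi : Integrable (fun x => (weightAt N (ev.score L x) : ℝ)) ν)
    (hWgi : Integrable (fun x => (weightAt N (ev.score L x) : ℝ) * g x) ν)
    (hpos : 0 < ∫ x, (weightAt N (ev.score L x) : ℝ) ∂ν) :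
    ∀ᵐ s ∂(Measure.infinitePi fun _ : ℕ => ν),
      Tendsto (fun n => ev.estimate L g n s) atTop
        (𝓝 ((∫ x, (weightAt N (ev.score L x) : ℝ) * g x ∂ν) /
          ∫ x, (weightAt N (ev.score L x) : ℝ) ∂ν)) := by
  have hW : Measurable fun x => (weightAt N (ev.score L x) : ℝ) :=
    (measurable_weightAt.comp
      (measurable_const.prodMk (ev.measurable_score L))).coe_nnreal_real
  have hle' : ∀ᵐ s ∂(Measure.infinitePi fun _ : ℕ => ν), ∀ k, N ≤ (ev.score L (s k)).1 := by
    rw [ae_all_iff]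
    intro k
    exact (measurePreserving_eval_infinitePi (fun _ : ℕ => ν) k).quasiMeasurePreserving.ae hle
  filter_upwards [hle', ae_tendsto_average_infinitePi hW hWi,
    ae_tendsto_average_infinitePi (hW.mul hg) hWgi] with s hs hs1 hs2
  refine (hs2.div hs1 hpos.ne').congr' ?_
  -- The average weight at level `N` is eventually positive, so some sample attains that level with
  -- nonzero weight; `0 < n` allows the common factor 1/n to cancel.
  filter_upwards [hs1.eventually_const_lt hpos, eventually_gt_atTop 0] with n hn hn0
  have hex : ∃ k < n, weightAt N (ev.score L (s k)) ≠ 0 := by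
    by_contra! h
    rw [Finset.sum_eq_zero fun k hk => by simp [h k (Finset.mem_range.1 hk)]] at hn
    simp at hn
  rw [ev.estimate_eq g (ev.minDensities_eq hs hex)]
  exact div_div_div_cancel_right₀ (by positivity) _ _

end MixedEvidence

end MTBN

/-! ### The posterior kernel and its normalization -/

namespace MTBN

variable {V : Type*} {M : MTBN V}

namespace MixedEvidence

variable [DecidableEq V] {E : Finset V} (ev : M.MixedEvidence E)

/-- The mean over the samples of the weights with `N e` densities. -/
noncomputable def meanWeight (L : List V) (x₀ : M.Joint) (N : (∀ u : E, M.X u) → ℕ)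
    (e : ∀ u : E, M.X u) : ℝ≥0∞ :=
  ∫⁻ x, weightAt (N e) (ev.score L x) ∂(M.sampleLaw L E e x₀)

theorem measurable_meanWeight (L : List V) (x₀ : M.Joint) {N : (∀ u : E, M.X u) → ℕ}
    (hN : Measurable N) : Measurable (ev.meanWeight L x₀ N) :=
  (ev.measurable_weightAt_score_uncurry L hN).lintegral_kernel_prod_right'
    (κ := M.sampleKernel L E x₀)

/-- The law of a sample with the normalized weights. -/
noncomputable def posterior (L : List V) (x₀ : M.Joint) (N : (∀ u : E, M.X u) → ℕ) :
    Kernel (∀ u : E, M.X u) M.Joint :=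
  (M.sampleKernel L E x₀).withDensity fun e x =>
    (((ev.meanWeight L x₀ N e)⁻¹.toNNReal * weightAt (N e) (ev.score L x) : ℝ≥0) : ℝ≥0∞)

instance (L : List V) (x₀ : M.Joint) (N : (∀ u : E, M.X u) → ℕ) :
    IsSFiniteKernel (ev.posterior L x₀ N) :=
  Kernel.IsSFiniteKernel.withDensity _ fun _ _ => ENNReal.coe_ne_top

theorem measurable_posterior_density (L : List V) (x₀ : M.Joint) {N : (∀ u : E, M.X u) → ℕ}
    (hN : Measurable N) :
    Measurable fun q : (∀ u : E, M.X u) × M.Joint =>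
      (ev.meanWeight L x₀ N q.1)⁻¹.toNNReal * weightAt (N q.1) (ev.score L q.2) :=
  (((ev.measurable_meanWeight L x₀ hN).inv.ennreal_toNNReal).comp measurable_fst).mul
    (measurable_weightAt.comp ((hN.comp measurable_fst).prodMk
      ((ev.measurable_score L).comp measurable_snd)))

theorem posterior_apply (L : List V) (x₀ : M.Joint) {N : (∀ u : E, M.X u) → ℕ}
    (hN : Measurable N) (e : ∀ u : E, M.X u) :
    ev.posterior L x₀ N e = (M.sampleLaw L E e x₀).withDensity fun x =>
      (((ev.meanWeight L x₀ N e)⁻¹.toNNReal * weightAt (N e) (ev.score L x) : ℝ≥0) : ℝ≥0∞) :=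
  Kernel.withDensity_apply _ (ev.measurable_posterior_density L x₀ hN).coe_nnreal_ennreal e

theorem measurable_posterior_density_apply (L : List V) (x₀ : M.Joint)
    (N : (∀ u : E, M.X u) → ℕ) (e : ∀ u : E, M.X u) :
    Measurable fun x : M.Joint =>
      (ev.meanWeight L x₀ N e)⁻¹.toNNReal * weightAt (N e) (ev.score L x) :=
  measurable_const.mul (measurable_weightAt.comp
    (measurable_const.prodMk (ev.measurable_score L)))

theorem lintegral_posterior (L : List V) (x₀ : M.Joint) {N : (∀ u : E, M.X u) → ℕ}
    (hN : Measurable N) (e : ∀ u : E, M.X u) {H : M.Joint → ℝ≥0∞} (hH : Measurable H) :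
    ∫⁻ x, H x ∂(ev.posterior L x₀ N e) =
      (ev.meanWeight L x₀ N e)⁻¹.toNNReal *
        ∫⁻ x, weightAt (N e) (ev.score L x) * H x ∂(M.sampleLaw L E e x₀) := by
  rw [ev.posterior_apply L x₀ hN, lintegral_withDensity_eq_lintegral_mul _
    (ev.measurable_posterior_density_apply L x₀ N e).coe_nnreal_ennreal hH,
    ← lintegral_const_mul _ (ev.measurable_weightAt_score_mul L _ hH)]
  refine lintegral_congr fun x => ?_
  rw [Pi.mul_apply, ENNReal.coe_mul, mul_assoc]

theorem ae_sampleLaw_obs_eq [Finite V] (ev : M.MixedEvidence E) {L : List V}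
    (hL : ∀ v, v ∈ L) (e : ∀ u : E, M.X u)
    (x₀ : M.Joint) : ∀ᵐ x ∂(M.sampleLaw L E e x₀), M.obs E x = e := by
  have := ae_all_iff.2 fun u : E => ev.ae_sampleLaw_eq L e x₀ u.2 (hL u)
  filter_upwards [this] with x hx
  exact funext hx

variable {ev}

namespace IsDisintegration

variable {μ : Measure M.Joint} {L : List V} {x₀ : M.Joint} {ρ : Measure (∀ u : E, M.X u)}
  {N : (∀ u : E, M.X u) → ℕ}

/-- Test the disintegration on functions of the observations: they are constant under each sampling
law, so only the mean weight remains. -/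
theorem map_obs [Finite V] (h : ev.IsDisintegration L x₀ ρ N) (hμ : M.Represents μ)
    (hL : M.IsTopologicalOrder L) :
    μ.map (M.obs E) = ρ.withDensity (ev.meanWeight L x₀ N) := by
  refine Measure.ext_of_lintegral _ fun Φ hΦ => ?_
  have hZ := ev.measurable_meanWeight L x₀ h.measurable
  have hΦo : Measurable fun x => Φ (M.obs E x) := hΦ.comp (measurable_obs E)
  rw [lintegral_map hΦ (measurable_obs E), lintegral_withDensity_eq_lintegral_mul _ hZ hΦ,
    ← hμ.eq_sampleLaw hL x₀, h.lintegral_eq _ hΦo]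
  refine lintegral_congr fun e => ?_
  rw [Pi.mul_apply, meanWeight, ← lintegral_mul_const _ (ev.measurable_weightAt_score L _)]
  refine lintegral_congr_ae ?_
  filter_upwards [ev.ae_sampleLaw_obs_eq hL.complete e x₀] with x hx
  rw [hx]

/-- The mean weight is the density of a finite measure. -/
theorem ae_meanWeight_lt_top [Finite V] (h : ev.IsDisintegration L x₀ ρ N) (hμ : M.Represents μ)
    (hL : M.IsTopologicalOrder L) : ∀ᵐ e ∂ρ, ev.meanWeight L x₀ N e < ∞ := by
  have := hμ.prob
  refine ae_lt_top (ev.measurable_meanWeight L x₀ h.measurable) ?_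
  rw [← setLIntegral_univ, ← withDensity_apply _ MeasurableSet.univ, ← h.map_obs hμ hL,
    Measure.map_apply (measurable_obs E) MeasurableSet.univ]
  exact measure_ne_top _ _

theorem ae_map_obs_meanWeight [Finite V] (h : ev.IsDisintegration L x₀ ρ N)
    (hμ : M.Represents μ) (hL : M.IsTopologicalOrder L) :
    ∀ᵐ e ∂(μ.map (M.obs E)), ev.meanWeight L x₀ N e ≠ 0 ∧ ev.meanWeight L x₀ N e ≠ ∞ := by
  rw [h.map_obs hμ hL, ae_withDensity_iff (ev.measurable_meanWeight L x₀ h.measurable)]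
  filter_upwards [h.ae_meanWeight_lt_top hμ hL] with e he h0 using ⟨h0, he.ne⟩

theorem posterior_comp [Finite V] (h : ev.IsDisintegration L x₀ ρ N) (hμ : M.Represents μ)
    (hL : M.IsTopologicalOrder L) : ev.posterior L x₀ N ∘ₘ (μ.map (M.obs E)) = μ := by
  refine Measure.ext_of_lintegral _ fun H hH => ?_
  rw [Measure.lintegral_bind (Kernel.aemeasurable _) hH.aemeasurable, h.map_obs hμ hL,
    lintegral_withDensity_eq_lintegral_mul _ (ev.measurable_meanWeight L x₀ h.measurable)
      hH.lintegral_kernel]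
  conv_rhs => rw [← hμ.eq_sampleLaw hL x₀, h.lintegral_eq _ hH]
  refine lintegral_congr_ae ?_
  filter_upwards [h.ae_meanWeight_lt_top hμ hL] with e he
  rw [Pi.mul_apply, ev.lintegral_posterior L x₀ h.measurable e hH]
  -- If the mean weight is zero, the weights vanish almost surely and both sides are zero; otherwise
  -- the normalization cancels.
  by_cases h0 : ev.meanWeight L x₀ N e = 0
  · rw [h0, zero_mul]
    rw [meanWeight, lintegral_eq_zero_iff (ev.measurable_weightAt_score L _)] at h0
    refine ((lintegral_congr_ae ?_).trans lintegral_zero).symm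
    filter_upwards [h0] with x hx
    simp only [Pi.zero_apply] at hx
    rw [hx, zero_mul]
  · rw [ENNReal.coe_toNNReal (ENNReal.inv_ne_top.2 h0), ← mul_assoc,
      ENNReal.mul_inv_cancel h0 he.ne, one_mul]

theorem ae_posterior_obs_eq [Finite V] (h : ev.IsDisintegration L x₀ ρ N)
    (hL : M.IsTopologicalOrder L) (e : ∀ u : E, M.X u) :
    ∀ᵐ x ∂(ev.posterior L x₀ N e), M.obs E x = e := by
  rw [ev.posterior_apply L x₀ h.measurable]
  exact (withDensity_absolutelyContinuous _ _).ae_le (ev.ae_sampleLaw_obs_eq hL.complete e x₀)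

/-- At regular observations, the estimates converge to the posterior mean. -/
theorem ae_tendsto_estimate (h : ev.IsDisintegration L x₀ ρ N) {e : ∀ u : E, M.X u}
    (h0 : ev.meanWeight L x₀ N e ≠ 0) (htop : ev.meanWeight L x₀ N e ≠ ∞) {g : M.Joint → ℝ}
    (hg : Measurable g) (hgi : Integrable g (ev.posterior L x₀ N e)) :
    ∀ᵐ s ∂(Measure.infinitePi fun _ : ℕ => M.sampleLaw L E e x₀),
      Tendsto (fun n => ev.estimate L g n s) atTop (𝓝 (∫ x, g x ∂(ev.posterior L x₀ N e))) := by
  have hd := ev.measurable_posterior_density_apply L x₀ N e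
  set c := (ev.meanWeight L x₀ N e)⁻¹.toNNReal with hc
  -- `toNNReal` sends the inverse to 0 when the mean weight is 0 or ∞; regularity of the observation
  -- excludes both.
  have hc0 : (c : ℝ) ≠ 0 := by
    simp [hc, ENNReal.toNNReal_eq_zero_iff, h0, htop]
  have hWm : Measurable fun x => (weightAt (N e) (ev.score L x) : ℝ) :=
    (measurable_weightAt.comp
      (measurable_const.prodMk (ev.measurable_score L))).coe_nnreal_real
  have hWi : Integrable (fun x => (weightAt (N e) (ev.score L x) : ℝ)) (M.sampleLaw L E e x₀) := by
    refine ⟨hWm.aestronglyMeasurable, ?_⟩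
    rw [hasFiniteIntegral_iff_ofReal (ae_of_all _ fun x => NNReal.coe_nonneg _)]
    simp only [ENNReal.ofReal_coe_nnreal]
    exact htop.lt_top
  have hint : ∫ x, (weightAt (N e) (ev.score L x) : ℝ) ∂(M.sampleLaw L E e x₀) =
      (ev.meanWeight L x₀ N e).toReal := by
    rw [integral_eq_lintegral_of_nonneg_ae (ae_of_all _ fun x => NNReal.coe_nonneg _)
      hWm.aestronglyMeasurable]
    simp only [ENNReal.ofReal_coe_nnreal, meanWeight]
  have hsmul : (fun x => (c * weightAt (N e) (ev.score L x)) • g x) =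
      fun x => (c : ℝ) * ((weightAt (N e) (ev.score L x) : ℝ) * g x) := by
    ext x
    rw [NNReal.smul_def, NNReal.coe_mul, smul_eq_mul, mul_assoc]
  have hWgi : Integrable (fun x => (weightAt (N e) (ev.score L x) : ℝ) * g x)
      (M.sampleLaw L E e x₀) := by
    rw [ev.posterior_apply L x₀ h.measurable,
      integrable_withDensity_iff_integrable_smul hd, hsmul] at hgi
    exact (integrable_const_mul_iff (IsUnit.mk0 _ hc0) _).1 hgi
  have hmean : ∫ x, g x ∂(ev.posterior L x₀ N e) =
      (∫ x, (weightAt (N e) (ev.score L x) : ℝ) * g x ∂(M.sampleLaw L E e x₀)) /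
        ∫ x, (weightAt (N e) (ev.score L x) : ℝ) ∂(M.sampleLaw L E e x₀) := by
    rw [ev.posterior_apply L x₀ h.measurable, integral_withDensity_eq_integral_smul hd, hsmul,
      integral_const_mul, hint, div_eq_inv_mul, ← ENNReal.toReal_inv]
    rfl
  rw [hmean]
  refine ev.ae_tendsto_estimate (h.le_score e) hg hWi hWgi ?_
  rw [hint]
  exact ENNReal.toReal_pos h0 htop

end IsDisintegration

end MixedEvidence

end MTBN

/-! ### Consistency -/

open MTBN in
theorem theorem2 {V : Type*} [Finite V] [DecidableEq V] (M : MTBN V)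
    (μ : Measure M.Joint) (hμ : M.Represents μ)
    (E : Finset V) (ev : M.MixedEvidence E)
    (hcount : ∀ (v : E) (e : ∀ u : E, M.X u),
      {y : ℝ | ∃ p : M.ParentVal v,
        (∀ (u : {u // M.edge u v}) (hu : u.1 ∈ E), p u = e ⟨u.1, hu⟩) ∧
          ev.mass v p y ≠ 0}.Countable)
    (L : List V) (hL : M.IsTopologicalOrder L) (x₀ : M.Joint)
    (g : M.Joint → ℝ) (hg : Measurable g) (hgi : Integrable g μ) :
    ∀ᵐ x ∂μ, ∀ᵐ s ∂(Measure.infinitePi fun _ : ℕ => M.sampleLaw L E (M.obs E x) x₀),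
      Tendsto (fun n => ev.estimate L g n s) atTop
        (𝓝 ((μ[g | MeasurableSpace.comap (M.obs E) inferInstance]) x)) := by
  have := hμ.prob
  obtain ⟨ρ, N, h⟩ := ev.exists_isDisintegration hcount hL.isAncestralOrder x₀
  have hcomp := h.posterior_comp hμ hL
  have hgi' : ∀ᵐ e ∂(μ.map (M.obs E)), Integrable g (ev.posterior L x₀ N e) :=
    Measure.ae_integrable_of_integrable_comp (hcomp.symm ▸ hgi)
  filter_upwards [condExp_ae_eq_integral_kernel (measurable_obs E) hcomp
      (ae_of_all _ (h.ae_posterior_obs_eq hL)) hg hgi,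
    ae_of_ae_map (measurable_obs E).aemeasurable hgi',
    ae_of_ae_map (measurable_obs E).aemeasurable (h.ae_map_obs_meanWeight hμ hL)]
    with x hx hxi hxw
  rw [hx]
  exact h.ae_tendsto_estimate hxw.1 hxw.2 hg hxi
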